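/- Let $G$ be an Abelian topological group, written additively (no local compactness, metrizability or separation axiom is assumed), let $F$ be $\mathbb{R}$ or $\mathbb{C}$, and let $C_b(G,F)$ be the space of bounded continuous functions $G \to F$ with the sup norm $\|\cdot\|_\infty$. For $s \in G$ let $T_s$ be the translation operator $(T_s f)(x) = f(s+x)$ on $C_b(G,F)$, and call $f \in C_b(G,F)$ almost periodic if the set $\{T_s f : s \in G\}$ is totally bounded in $C_b(G,F)$. A character of $G$ is a continuous function $\chi : G \to \mathbb{C}$ with $|\chi(x)| = 1$ and $\chi(x+y) = \chi(x)\chi(y)$ for all $x, y \in G$. Theorem (Bohr approximation theorem, Abelian case). Let $f \in C_b(G,F)$ be almost periodic. Then for every $\varepsilon > 0$ there is an almost periodic function $p \in C_b(G,F)$ which, regarded as a complex-valued function, is a finite linear combination of characters of $G$ with complex coefficients, such that $\|f - p\|_\infty < \varepsilon$. -/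

import Mathlib

open scoped BoundedContinuousFunction

namespace BohrAP

/-- The translation operator `T_s` on bounded continuous functions: `(T_s f)(x) = f (s + x)`. -/
noncomputable def translate {G F : Type*} [AddCommGroup G] [TopologicalSpace G]
    [IsTopologicalAddGroup G] [RCLike F] (s : G) (f : G →ᵇ F) : G →ᵇ F :=
  f.compContinuous ⟨fun x => s + x, continuous_const.add continuous_id⟩

/-- `f` is almost periodic if its set of translates `{T_s f : s ∈ G}` is totally bounded in
`C_b(G, F)` for the sup norm. -/
def IsAlmostPeriodic {G F : Type*} [AddCommGroup G] [TopologicalSpace G]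
    [IsTopologicalAddGroup G] [RCLike F] (f : G →ᵇ F) : Prop :=
  TotallyBounded {g : G →ᵇ F | ∃ s : G, g = translate s f}

/-- A character of `G`: a continuous function `χ : G → ℂ` with `|χ(x)| = 1` and
`χ(x + y) = χ(x) χ(y)`. -/
structure IsCharacter {G : Type*} [AddCommGroup G] [TopologicalSpace G] (χ : G → ℂ) : Prop where
  continuous : Continuous χ
  norm_eq_one : ∀ x, ‖χ x‖ = 1
  map_add : ∀ x y, χ (x + y) = χ x * χ y

/-- A finite linear combination, with complex coefficients, of characters of `G`. -/
def IsCharacterCombination {G : Type*} [AddCommGroup G] [TopologicalSpace G] (p : G → ℂ) : Prop :=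
  p ∈ Submodule.span ℂ {χ : G → ℂ | IsCharacter χ}

end BohrAP

/-!
An almost periodic `f` lives on a compact group. The seminorm `s ↦ ‖T_s f - f‖` on `G` is invariant,
and the total boundedness of the orbit of `f` says that the completion `K` of `G` for this seminorm is
a compact abelian group. The canonical map `G → K` is continuous because `f` is uniformly continuous,
and `f` extends to a continuous function on `K`
(`IsAlmostPeriodic.exists_compactSpace_extension`). Conversely every continuous function on `K` pulls
back to an almost periodic function on `G`, and characters pull back to characters. So it suffices to
approximate continuous functions on `K` by combinations of characters, and by the Stone-Weierstrass
theorem it is enough that characters of `K` separate points.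

Separation of points (`exists_character_ne_one`) is obtained from Gelfand theory. Let `U` be the regular
representation of `K` on `L²` of Haar measure, let `x ≠ 0`, choose `g` with `v = U(x) g - g ≠ 0`, and
put `a = ∫ ⟪U(t) v, v⟫ U(t) dt`. This operator is self-adjoint and commutes with all `U(t)`, and
`a v ≠ 0`, so `a (U(x) - 1) ≠ 0` in the commutative C⋆-algebra generated by `a` and the `U(t)`. Hence
some multiplicative functional `φ` satisfies `φ(a) (φ(U(x)) - 1) ≠ 0`, and `χ(t) = φ(U(t))` is a
homomorphism to the unit circle with `χ(x) ≠ 1`. It is continuous since `φ(U(t)) φ(a) = φ(U(t) a)`, where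
`t ↦ U(t) a` is norm continuous although `U` is in general only strongly continuous.

For the field `F`, the complex approximant is projected to `F`. When `F` is real this replaces it by its
real part, which is again a combination of characters because the conjugate of a character is a
character.
-/

open MeasureTheory
open scoped InnerProductSpace ComplexConjugate

namespace BohrAP

/-! ### Multiplicative functionals and averaging operators -/

/-- A commuting, star-closed set generates a commutative C⋆-algebra, on which the Gelfand transform
is injective. -/
theorem exists_starAlgHom_adjoin_ne_zero {A : Type*} [CStarAlgebra A] {S : Set A}
    (hcomm : ∀ a ∈ S, ∀ b ∈ S, a * b = b * a) (hstar : ∀ a ∈ S, star a ∈ S)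
    {a : A} (ha : a ∈ StarAlgebra.adjoin ℂ S) (ha0 : a ≠ 0) :
    ∃ φ : StarAlgebra.adjoin ℂ S →⋆ₐ[ℂ] ℂ, Continuous φ ∧ φ ⟨a, ha⟩ ≠ 0 := by
  let B := (StarAlgebra.adjoin ℂ S).topologicalClosure
  have : IsClosed (B : Set A) := StarSubalgebra.isClosed_topologicalClosure _
  have := StarAlgebra.isMulCommutative_adjoin ℂ hcomm fun a ha b hb => hcomm a ha _ (hstar b hb)
  let _ : CommRing B := StarSubalgebra.commRingTopologicalClosure _ mul_comm'
  let _ : CommCStarAlgebra B :=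
    { (inferInstance : CStarAlgebra B) with mul_comm := mul_comm }
  have hle : StarAlgebra.adjoin ℂ S ≤ B := StarSubalgebra.le_topologicalClosure _
  have hne : WeakDual.gelfandTransform ℂ B ⟨a, hle ha⟩ ≠ 0 := fun h => ha0 <| by
    have h' := (gelfandTransform_isometry B).injective (h.trans (map_zero _).symm)
    exact congrArg Subtype.val h'
  obtain ⟨φ, hφ⟩ : ∃ φ, WeakDual.gelfandTransform ℂ B ⟨a, hle ha⟩ φ ≠ 0 := by
    by_contra! h
    exact hne (ContinuousMap.ext h)
  let ψ : B →⋆ₐ[ℂ] ℂ :=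
    { WeakDual.CharacterSpace.equivAlgHom φ with map_star' := fun b => map_star φ b }
  refine ⟨ψ.comp (StarSubalgebra.inclusion hle), ?_, hφ⟩
  have h1 : Continuous φ := map_continuous φ
  exact h1.comp (StarSubalgebra.isEmbedding_inclusion hle).continuous

section Isometric

variable {K : Type*} [AddCommGroup K] {H : Type*} [NormedAddCommGroup H] [InnerProductSpace ℂ H]

theorem inner_map_left_eq (U : AddChar K (H →ₗᵢ[ℂ] H)) (s : K) (v w : H) :
    ⟪U s v, w⟫_ℂ = ⟪v, U (-s) w⟫_ℂ := by
  have h : U s (U (-s) w) = w := by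
    change (U s * U (-s)) w = w
    rw [← AddChar.map_add_eq_mul, add_neg_cancel, AddChar.map_zero_eq_one]
    rfl
  conv_lhs => rw [← h]
  exact (U s).inner_map_map _ _

theorem star_toContinuousLinearMap [CompleteSpace H] (U : AddChar K (H →ₗᵢ[ℂ] H)) (s : K) :
    star (U s).toContinuousLinearMap = (U (-s)).toContinuousLinearMap := by
  rw [ContinuousLinearMap.star_eq_adjoint, eq_comm, ContinuousLinearMap.eq_adjoint_iff]
  intro v w
  simpa using inner_map_left_eq U (-s) v w

end Isometric

section Representation

variable {K : Type*} [AddCommGroup K] [TopologicalSpace K]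
  [CompactSpace K] [MeasurableSpace K] [BorelSpace K]
  {H : Type*} [NormedAddCommGroup H] [InnerProductSpace ℂ H]

theorem integrable_smul_orbit (μ : Measure K) [IsFiniteMeasure μ]
    {U : AddChar K (H →ₗᵢ[ℂ] H)} (hU : ∀ v, Continuous fun t => U t v) (k : C(K, ℂ)) (v : H) :
    Integrable (fun t => k t • U t v) μ :=
  (k.continuous.smul (hU v)).integrable_of_hasCompactSupport (HasCompactSupport.of_compactSpace _)

/-- The operator `v ↦ ∫ k(t) U(t) v dμ(t)` obtained by averaging a strongly continuous isometric
representation `U` of a compact group against a continuous kernel `k`. -/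
noncomputable def averageOperator (μ : Measure K) [IsFiniteMeasure μ] (U : AddChar K (H →ₗᵢ[ℂ] H))
    (hU : ∀ v, Continuous fun t => U t v) (k : C(K, ℂ)) : H →L[ℂ] H :=
  LinearMap.mkContinuous
    { toFun := fun v => ∫ t, k t • U t v ∂μ
      map_add' := fun v w => by
        simp only [map_add, smul_add]
        exact integral_add (integrable_smul_orbit μ hU k v) (integrable_smul_orbit μ hU k w)
      map_smul' := fun c v => by
        simp only [map_smul, RingHom.id_apply, smul_comm _ c]
        exact integral_smul c _ }
    (‖k‖ * μ.real Set.univ) fun v => by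
      refine (norm_integral_le_of_norm_le_const (C := ‖k‖ * ‖v‖) (.of_forall fun t => ?_)).trans_eq
        (by ring)
      rw [norm_smul, LinearIsometry.norm_map]
      gcongr
      exact k.norm_coe_le_norm t

variable {μ : Measure K} [IsFiniteMeasure μ] {U : AddChar K (H →ₗᵢ[ℂ] H)}
  {hU : ∀ v, Continuous fun t => U t v}

theorem averageOperator_apply (k : C(K, ℂ)) (v : H) :
    averageOperator μ U hU k v = ∫ t, k t • U t v ∂μ := rfl

theorem norm_averageOperator_le (k : C(K, ℂ)) :
    ‖averageOperator μ U hU k‖ ≤ ‖k‖ * μ.real Set.univ :=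
  LinearMap.mkContinuous_norm_le _ (by positivity) _

theorem averageOperator_sub (k l : C(K, ℂ)) :
    averageOperator μ U hU (k - l) = averageOperator μ U hU k - averageOperator μ U hU l := by
  ext v
  simp only [averageOperator_apply, _root_.sub_apply, ContinuousMap.sub_apply, sub_smul]
  exact integral_sub (integrable_smul_orbit μ hU k v) (integrable_smul_orbit μ hU l v)

theorem continuous_averageOperator : Continuous (averageOperator μ U hU) := by
  refine (LipschitzWith.of_dist_le_mul (K := ⟨μ.real Set.univ, by positivity⟩)
    fun k l => ?_).continuous
  rw [dist_eq_norm, dist_eq_norm, ← averageOperator_sub, mul_comm]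
  exact norm_averageOperator_le _

theorem mul_averageOperator_comm [CompleteSpace H] (k : C(K, ℂ)) (s : K) :
    (U s).toContinuousLinearMap * averageOperator μ U hU k =
      averageOperator μ U hU k * (U s).toContinuousLinearMap := by
  ext v
  simp only [mul_apply_eq_comp, averageOperator_apply]
  rw [← ContinuousLinearMap.integral_comp_comm _ (integrable_smul_orbit μ hU k v)]
  congr! 2 with t
  rw [map_smul]
  congr 1
  change (U s * U t) v = (U t * U s) v
  rw [← AddChar.map_add_eq_mul, ← AddChar.map_add_eq_mul, add_comm]

theorem mul_averageOperator_eq [CompleteSpace H] [IsTopologicalAddGroup K]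
    [μ.IsAddLeftInvariant] (k : C(K, ℂ)) (s : K) :
    (U s).toContinuousLinearMap * averageOperator μ U hU k =
      averageOperator μ U hU (k.comp ⟨fun t => -s + t, by fun_prop⟩) := by
  ext v
  simp only [mul_apply_eq_comp, averageOperator_apply]
  rw [← ContinuousLinearMap.integral_comp_comm _ (integrable_smul_orbit μ hU k v),
    ← integral_add_left_eq_self (fun t => _ • U t v) s]
  congr! 2 with t
  rw [map_smul]
  simp only [ContinuousMap.comp_apply, ContinuousMap.coe_mk, neg_add_cancel_left]
  rw [AddChar.map_add_eq_mul]
  rfl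

/-- The product with an averaging operator is norm continuous in the group variable, even though
`U` itself is only strongly continuous. -/
theorem continuous_mul_averageOperator [CompleteSpace H] [IsTopologicalAddGroup K]
    [μ.IsAddLeftInvariant] (k : C(K, ℂ)) :
    Continuous fun s => (U s).toContinuousLinearMap * averageOperator μ U hU k := by
  simp only [mul_averageOperator_eq]
  let F : C(K × K, ℂ) := ⟨fun x => k (-x.1 + x.2), by fun_prop⟩
  exact continuous_averageOperator.comp F.curry.continuous

theorem isSelfAdjoint_averageOperator [IsTopologicalAddGroup K] [CompleteSpace H]
    [μ.IsAddLeftInvariant] [μ.IsNegInvariant] {k : C(K, ℂ)}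
    (hk : ∀ t, k (-t) = conj (k t)) : IsSelfAdjoint (averageOperator μ U hU k) := by
  rw [ContinuousLinearMap.isSelfAdjoint_iff_isSymmetric]
  intro v w
  change ⟪averageOperator μ U hU k v, w⟫_ℂ = ⟪v, averageOperator μ U hU k w⟫_ℂ
  rw [averageOperator_apply, averageOperator_apply,
    ← integral_inner (integrable_smul_orbit μ hU k w) v, ← inner_conj_symm,
    ← integral_inner (integrable_smul_orbit μ hU k v) w, ← integral_conj,
    ← integral_neg_eq_self]
  congr! 2 with t
  rw [inner_conj_symm, inner_smul_left, inner_smul_right, hk, RCLike.conj_conj,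
    inner_map_left_eq, neg_neg]

/-- For the kernel `k(t) = ⟪U(t) v, v⟫` one has `⟪v, ∫ k(t) U(t) v⟫ = ∫ |k|²`, which is positive
because `k(0) = ‖v‖²`. -/
theorem averageOperator_ne_zero [CompleteSpace H] [μ.IsOpenPosMeasure] {v : H} (hv : v ≠ 0)
    {k : C(K, ℂ)} (hk : ∀ t, k t = ⟪U t v, v⟫_ℂ) : averageOperator μ U hU k v ≠ 0 := by
  intro h
  have h1 : ∫ t, ((‖k t‖ ^ 2 : ℝ) : ℂ) ∂μ = 0 := by
    have h2 : ⟪v, averageOperator μ U hU k v⟫_ℂ = 0 := by rw [h, inner_zero_right]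
    rw [averageOperator_apply, ← integral_inner (integrable_smul_orbit μ hU k v) v] at h2
    rw [← h2]
    congr! 2 with t
    rw [inner_smul_right, ← inner_conj_symm, ← hk, RCLike.mul_conj]
    norm_cast
  rw [integral_complex_ofReal, Complex.ofReal_eq_zero] at h1
  have hc : Continuous fun t => ‖k t‖ ^ 2 := by fun_prop
  have h0 : ‖k 0‖ ^ 2 ≠ 0 := by
    rw [hk, AddChar.map_zero_eq_one]
    simpa using hv
  exact (hc.integral_pos_of_hasCompactSupport_nonneg_nonzero (HasCompactSupport.of_compactSpace _)
    (fun t => sq_nonneg _) h0).ne' h1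

/-- With `a` the averaging operator of the kernel `⟪U(t) v, v⟫`, `v = U(x) g - g`, the operator
`a (U(x) - 1)` is nonzero, so some multiplicative functional `φ` of the commutative C⋆-algebra
generated by `a` and the `U(t)` does not vanish on it. The character is `t ↦ φ(U(t))`. -/
theorem exists_character_ne_one_of_representation [IsTopologicalAddGroup K] [CompleteSpace H]
    [μ.IsAddLeftInvariant] [μ.IsNegInvariant]
    [μ.IsOpenPosMeasure] (U : AddChar K (H →ₗᵢ[ℂ] H)) (hU : ∀ v, Continuous fun t => U t v)
    {x : K} {g : H} (hx : U x g ≠ g) :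
    ∃ χ : K → ℂ, IsCharacter χ ∧ χ x ≠ 1 := by
  let v := U x g - g
  have hv0 : v ≠ 0 := sub_ne_zero.2 hx
  let k : C(K, ℂ) := ⟨fun t => ⟪U t v, v⟫_ℂ, (hU v).inner continuous_const⟩
  have hk : ∀ t, k (-t) = conj (k t) := fun t => by
    change ⟪U (-t) v, v⟫_ℂ = conj ⟪U t v, v⟫_ℂ
    rw [inner_map_left_eq, neg_neg, inner_conj_symm]
  let a := averageOperator μ U hU k
  have ha_star : star a = a := isSelfAdjoint_averageOperator hk
  let V : K → (H →L[ℂ] H) := fun s => (U s).toContinuousLinearMap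
  have hV_add : ∀ s t, V (s + t) = V s * V t := fun s t => by
    ext w
    change U (s + t) w = (U s * U t) w
    rw [AddChar.map_add_eq_mul]
  have hV_zero : V 0 = 1 := by
    ext w
    change U 0 w = w
    rw [AddChar.map_zero_eq_one]
    rfl
  have hVa : ∀ s, V s * a = a * V s := fun s => mul_averageOperator_comm k s
  let S : Set (H →L[ℂ] H) := insert a (Set.range V)
  have hcomm : ∀ b ∈ S, ∀ c ∈ S, b * c = c * b := by
    rintro b (rfl | ⟨s, rfl⟩) c (rfl | ⟨t, rfl⟩)
    · rfl
    · exact (hVa t).symm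
    · exact hVa s
    · rw [← hV_add, ← hV_add, add_comm]
  have hV_star : ∀ s, star (V s) = V (-s) := star_toContinuousLinearMap U
  have hstar : ∀ b ∈ S, star b ∈ S := by
    rintro b (rfl | ⟨s, rfl⟩)
    · rw [ha_star]; exact Set.mem_insert _ _
    · rw [hV_star]; exact Set.mem_insert_of_mem _ ⟨_, rfl⟩
  have haS : a ∈ StarAlgebra.adjoin ℂ S :=
    StarAlgebra.subset_adjoin ℂ S (Set.mem_insert _ _)
  have hVS : ∀ s, V s ∈ StarAlgebra.adjoin ℂ S := fun s =>
    StarAlgebra.subset_adjoin ℂ S (Set.mem_insert_of_mem _ ⟨s, rfl⟩)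
  let a' : StarAlgebra.adjoin ℂ S := ⟨a, haS⟩
  let V' : K → StarAlgebra.adjoin ℂ S := fun s => ⟨V s, hVS s⟩
  have hne : a * (V x - 1) ≠ 0 := fun h =>
    averageOperator_ne_zero (μ := μ) (hU := hU) hv0 (k := k) (fun _ => rfl) <| by
      have h' : a (U x g - g) = 0 := congrArg (fun T : H →L[ℂ] H => T g) h
      exact h'
  obtain ⟨φ, hφc, hφ⟩ := exists_starAlgHom_adjoin_ne_zero hcomm hstar
    (mul_mem haS (sub_mem (hVS x) (one_mem _))) hne
  have hφ' : φ a' * (φ (V' x) - 1) ≠ 0 := by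
    rw [← map_one φ, ← map_sub, ← map_mul]
    exact hφ
  have hφa : φ a' ≠ 0 := left_ne_zero_of_mul hφ'
  have hχ_add : ∀ s t, φ (V' (s + t)) = φ (V' s) * φ (V' t) := fun s t => by
    rw [← map_mul]
    exact congrArg φ (Subtype.ext (hV_add s t))
  refine ⟨fun s => φ (V' s), ⟨?_, fun s => ?_, hχ_add⟩, sub_ne_zero.1 (right_ne_zero_of_mul hφ')⟩
  -- `s ↦ V s * a` is norm continuous, whereas `V` need not be; `φ a ≠ 0` can be divided out.
  · have h1 : Continuous fun s => φ (V' s * a') :=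
      hφc.comp ((continuous_mul_averageOperator (hU := hU) k).subtype_mk _)
    have h2 : (fun s => φ (V' s)) = fun s => φ (V' s * a') / φ a' := by
      ext s
      rw [map_mul, mul_div_cancel_right₀ _ hφa]
    rw [h2]
    exact h1.div_const _
  · have h1 : φ (V' (-s)) = conj (φ (V' s)) := by
      rw [← RCLike.star_def, ← map_star]
      exact congrArg φ (Subtype.ext (hV_star s).symm)
    have h2 : φ (V' 0) = 1 := by
      rw [← map_one φ]
      exact congrArg φ (Subtype.ext hV_zero)
    have h3 : φ (V' s) * conj (φ (V' s)) = 1 := by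
      rw [← h1, ← hχ_add, add_neg_cancel, h2]
    rw [RCLike.mul_conj] at h3
    have h4 : ‖φ (V' s)‖ ^ 2 = 1 := Complex.ofReal_injective (by simpa using h3)
    exact (pow_eq_one_iff_of_nonneg (norm_nonneg _) two_ne_zero).1 h4

end Representation

/-! ### Characters of compact abelian groups -/

section CompactGroup

variable {K : Type*} [AddCommGroup K] [TopologicalSpace K] [IsTopologicalAddGroup K]
  [CompactSpace K] [T2Space K]

/-- The regular representation of an additive group on `L²`, acting by `(U(s) g)(y) = g(s + y)`. -/
noncomputable def regularRepresentation [MeasurableSpace K] [BorelSpace K] (μ : Measure K)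
    [μ.IsAddLeftInvariant] : AddChar K (Lp ℂ 2 μ →ₗᵢ[ℂ] Lp ℂ 2 μ) where
  toFun s := Lp.compMeasurePreservingₗᵢ ℂ (s + ·) (measurePreserving_add_left μ s)
  map_zero_eq_one' := by
    ext1 g
    change Lp.compMeasurePreserving _ _ g = g
    simp only [zero_add]
    exact Lp.compMeasurePreserving_id_apply g
  map_add_eq_mul' s t := by
    ext1 g
    change Lp.compMeasurePreserving _ _ g =
      Lp.compMeasurePreserving _ _ (Lp.compMeasurePreserving _ _ g)
    rw [← Lp.compMeasurePreserving_comp_apply]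
    congr! 2
    ext y
    simp only [Function.comp_apply]
    abel

/-- Characters of a compact Hausdorff abelian group separate points: a continuous function taking
different values at `0` and `x` is moved by `x` in the regular representation. -/
theorem exists_character_ne_one {x : K} (hx : x ≠ 0) :
    ∃ χ : K → ℂ, IsCharacter χ ∧ χ x ≠ 1 := by
  borelize K
  let μ : Measure K := Measure.addHaar
  obtain ⟨u, hu0, hu1, -⟩ := exists_continuous_zero_one_of_isClosed
    (isClosed_singleton (x := (0 : K))) (isClosed_singleton (x := x))
    (Set.disjoint_singleton.2 hx.symm)
  let w : C(K, ℂ) := ⟨fun y => (u y : ℂ), by fun_prop⟩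
  let g : Lp ℂ 2 μ := ContinuousMap.toLp 2 μ ℂ w
  refine exists_character_ne_one_of_representation (μ := μ) (regularRepresentation μ)
    (fun v => ?_) (x := x) (g := g) fun h => ?_
  · let F : C(K × K, K) := ⟨fun y => y.1 + y.2, by fun_prop⟩
    exact (continuous_const (y := v)).compMeasurePreservingLp F.curry.continuous
      (fun s => measurePreserving_add_left μ s) (by simp)
  · have h1 : ContinuousMap.toLp 2 μ ℂ (w.comp ⟨fun y => x + y, by fun_prop⟩) = g := h
    have h2 := DFunLike.congr_fun (ContinuousMap.toLp_injective μ h1) 0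
    simp [w, hu0 rfl, hu1 rfl] at h2

/-- The characters of `K` span a star subalgebra of `C(K, ℂ)`, which is dense by the
Stone-Weierstrass theorem since characters separate points. -/
theorem exists_mem_span_character_norm_sub_lt (f : C(K, ℂ)) {ε : ℝ} (hε : 0 < ε) :
    ∃ q ∈ Submodule.span ℂ {χ : C(K, ℂ) | IsCharacter χ}, ‖f - q‖ < ε := by
  let M : Submonoid C(K, ℂ) :=
    { carrier := {χ | IsCharacter χ}
      one_mem' := ⟨continuous_const, fun _ => by simp, fun _ _ => by simp⟩
      mul_mem' := fun {χ ψ} hχ hψ => ⟨(χ * ψ).continuous,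
        fun x => by simp [hχ.norm_eq_one, hψ.norm_eq_one],
        fun x y => by simp only [ContinuousMap.mul_apply, hχ.map_add, hψ.map_add]; ring⟩ }
  have hM : star (M : Set C(K, ℂ)) ⊆ M := fun χ hχ => by
    have hχ : IsCharacter (star χ : C(K, ℂ)) := hχ
    refine ⟨χ.continuous, fun x => ?_, fun x y => ?_⟩
    · simpa using hχ.norm_eq_one x
    · simpa [-map_mul, ← map_mul, -star_mul'] using congrArg star (hχ.map_add x y)
  let A := StarAlgebra.adjoin ℂ (M : Set C(K, ℂ))
  have hA : Subalgebra.toSubmodule A.toSubalgebra = Submodule.span ℂ (M : Set C(K, ℂ)) := by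
    rw [StarAlgebra.adjoin_eq_span, Set.union_eq_self_of_subset_right hM, Submonoid.closure_eq]
  have hsep : A.SeparatesPoints := fun x y hxy => by
    obtain ⟨χ, hχ, hne⟩ := exists_character_ne_one (sub_ne_zero.2 hxy)
    refine ⟨χ, ⟨⟨χ, hχ.continuous⟩, StarAlgebra.subset_adjoin ℂ _ hχ, rfl⟩, fun h => hne ?_⟩
    have h1 := hχ.map_add (x - y) y
    have hy : χ y ≠ 0 := norm_ne_zero_iff.1 (by rw [hχ.norm_eq_one]; exact one_ne_zero)
    rw [sub_add_cancel, h] at h1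
    exact (mul_eq_right₀ hy).1 h1.symm
  have hf : f ∈ A.topologicalClosure := by
    rw [ContinuousMap.starSubalgebra_topologicalClosure_eq_top_of_separatesPoints A hsep]
    trivial
  obtain ⟨q, hq, hfq⟩ := Metric.mem_closure_iff.1 hf ε hε
  refine ⟨q, ?_, by rwa [← dist_eq_norm]⟩
  have hq' : q ∈ Subalgebra.toSubmodule A.toSubalgebra := hq
  rwa [hA] at hq'

end CompactGroup

/-! ### The compact group attached to an almost periodic function -/

section OrbitCompletion

variable {G F : Type*} [AddCommGroup G] [TopologicalSpace G] [IsTopologicalAddGroup G] [RCLike F]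

@[simp]
theorem translate_apply (s : G) (f : G →ᵇ F) (x : G) : translate s f x = f (s + x) := rfl

theorem dist_translate_add (f : G →ᵇ F) (r s t : G) :
    dist (translate (r + s) f) (translate (r + t) f) = dist (translate s f) (translate t f) := by
  -- The reverse inequality is the same one for the translation by `-r`.
  have key : ∀ r s t : G, dist (translate (r + s) f) (translate (r + t) f) ≤
      dist (translate s f) (translate t f) := fun r s t =>
    (BoundedContinuousFunction.dist_le dist_nonneg).2 fun x => by
      have h := BoundedContinuousFunction.dist_coe_le_dist (f := translate s f)
        (g := translate t f) (r + x)
      simpa [add_left_comm, add_assoc] using h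
  refine le_antisymm (key r s t) ?_
  simpa using key (-r) (r + s) (r + t)

/-- The invariant seminorm `s ↦ ‖T_s f - f‖` on `G`. -/
noncomputable def orbitSeminorm (f : G →ᵇ F) : AddGroupSeminorm G where
  toFun s := dist (translate s f) (translate 0 f)
  map_zero' := dist_self _
  add_le' s t := by
    refine (dist_triangle _ (translate (s + 0) f) _).trans ?_
    rw [dist_translate_add, add_zero, add_comm]
  neg' s := by
    have h := dist_translate_add f s (-s) 0
    rw [add_neg_cancel, add_zero, dist_comm] at h
    exact h.symm

/-- A copy of `G` carrying the seminorm `s ↦ ‖T_s f - f‖` in place of its own topology. -/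
def OrbitGroup (_f : G →ᵇ F) : Type _ := G

noncomputable instance (f : G →ᵇ F) : SeminormedAddCommGroup (OrbitGroup f) :=
  (orbitSeminorm f).toSeminormedAddCommGroup (E := G)

/-- The identity map from `G` to its copy `OrbitGroup f`. -/
def toOrbitGroup (f : G →ᵇ F) : G ≃+ OrbitGroup f := AddEquiv.refl G

theorem dist_toOrbitGroup (f : G →ᵇ F) (s t : G) :
    dist (toOrbitGroup f s) (toOrbitGroup f t) = dist (translate s f) (translate t f) := by
  change dist (translate (-s + t) f) (translate 0 f) = _
  rw [← dist_translate_add f s, add_neg_cancel_left, add_zero, dist_comm]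

/-- An almost periodic function is uniformly continuous: approximating `T_x f` by the members of a
finite net of the orbit reduces the modulus of continuity at `x` to finitely many points. -/
theorem IsAlmostPeriodic.continuous_toOrbitGroup {f : G →ᵇ F} (hf : IsAlmostPeriodic f) :
    Continuous (toOrbitGroup f) := by
  refine continuous_of_continuousAt_zero _ ?_
  rw [Metric.continuousAt_iff']
  intro ε hε
  obtain ⟨N, hN, hcov⟩ := Metric.totallyBounded_iff.1 hf (ε / 4) (by positivity)
  have hev : ∀ᶠ s in nhds (0 : G), ∀ g ∈ N, dist (g s) (g 0) < ε / 4 :=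
    (Filter.eventually_all_finite hN).2 fun g _ =>
      Metric.tendsto_nhds.1 (g.continuous.tendsto 0) _ (by positivity)
  filter_upwards [hev] with s hs
  rw [dist_toOrbitGroup]
  refine lt_of_le_of_lt (b := 3 * (ε / 4))
    ((BoundedContinuousFunction.dist_le (by positivity)).2 fun x => ?_) (by linarith)
  obtain ⟨g, hg, hxg⟩ := Set.mem_iUnion₂.1 (hcov ⟨x, rfl⟩)
  have hx : ∀ t, dist (f (x + t)) (g t) < ε / 4 := fun t =>
    (BoundedContinuousFunction.dist_coe_le_dist (f := translate x f) (g := g) t).trans_lt hxg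
  have h1 := hx s
  have h2 := hx 0
  have h3 := hs g hg
  have h4 := dist_triangle4 (f (x + s)) (g s) (g 0) (f (x + 0))
  rw [dist_comm (g 0)] at h4
  rw [translate_apply, translate_apply, add_comm s, add_comm 0]
  linarith

theorem isometry_translate_toOrbitGroup_symm (f : G →ᵇ F) :
    Isometry fun s => translate ((toOrbitGroup f).symm s) f :=
  Isometry.of_dist_eq fun s t =>
    (dist_toOrbitGroup f ((toOrbitGroup f).symm s) ((toOrbitGroup f).symm t)).symm

theorem IsAlmostPeriodic.compactSpace_completion {f : G →ᵇ F} (hf : IsAlmostPeriodic f) :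
    CompactSpace (UniformSpace.Completion (OrbitGroup f)) := by
  have htb : TotallyBounded (Set.univ : Set (OrbitGroup f)) := by
    refine (totallyBounded_preimage
      (isometry_translate_toOrbitGroup_symm f).isUniformInducing hf).subset fun s _ => ?_
    exact ⟨(toOrbitGroup f).symm s, rfl⟩
  refine ⟨TotallyBounded.isCompact_of_isClosed ?_ isClosed_univ⟩
  have h := (htb.image (UniformSpace.Completion.uniformContinuous_coe _)).closure
  rwa [Set.image_univ, UniformSpace.Completion.denseRange_coe.closure_range] at h

/-- `f` is uniformly continuous for the orbit seminorm, being the evaluation at `0` of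
`s ↦ T_s f`. -/
theorem uniformContinuous_comp_toOrbitGroup_symm (f : G →ᵇ F) :
    UniformContinuous fun s => f ((toOrbitGroup f).symm s) := by
  have h := (BoundedContinuousFunction.lipschitz_eval_const (β := F) (0 : G)).uniformContinuous.comp
    (isometry_translate_toOrbitGroup_symm f).uniformContinuous
  simpa [Function.comp_def] using h

universe u

/-- An almost periodic function factors through a continuous homomorphism to a compact group. -/
theorem IsAlmostPeriodic.exists_compactSpace_extension {G : Type u} [AddCommGroup G]
    [TopologicalSpace G] [IsTopologicalAddGroup G] {f : G →ᵇ F} (hf : IsAlmostPeriodic f) :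
    ∃ (K : Type u) (_ : NormedAddCommGroup K) (_ : CompactSpace K) (ι : G →+ K) (h : C(K, F)),
      Continuous ι ∧ ∀ x, h (ι x) = f x :=
  ⟨UniformSpace.Completion (OrbitGroup f), inferInstance, hf.compactSpace_completion,
    UniformSpace.Completion.toCompl.comp (toOrbitGroup f).toAddMonoidHom,
    ⟨_, UniformSpace.Completion.continuous_extension⟩,
    (UniformSpace.Completion.continuous_coe _).comp hf.continuous_toOrbitGroup, fun x =>
    UniformSpace.Completion.extension_coe (uniformContinuous_comp_toOrbitGroup_symm f)
      (toOrbitGroup f x)⟩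

end OrbitCompletion

/-! ### Pulling back to `G` and projecting to `F` -/

section Pullback

variable {G F : Type*} [AddCommGroup G] [TopologicalSpace G] [RCLike F]

/-- The translates of the pullback of `h` lie in the continuous image of `K` under
`k ↦ h (k + ι ·)`. -/
theorem isAlmostPeriodic_comp_of_compactSpace [IsTopologicalAddGroup G] {K : Type*}
    [AddCommGroup K] [TopologicalSpace K] [IsTopologicalAddGroup K] [CompactSpace K]
    {ι : G →+ K} (hι : Continuous ι) (h : C(K, F)) :
    IsAlmostPeriodic
      ((BoundedContinuousFunction.mkOfCompact h).compContinuous (⟨ι, hι⟩ : C(G, K))) := by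
  let T : C(K × K, F) := ⟨fun y => h (y.1 + y.2), by fun_prop⟩
  let Φ : K → (G →ᵇ F) := fun k =>
    (BoundedContinuousFunction.mkOfCompact (T.curry k)).compContinuous (⟨ι, hι⟩ : C(G, K))
  have hΦ : Continuous Φ :=
    (BoundedContinuousFunction.continuous_compContinuous _).comp
      ((ContinuousMap.isometryEquivBoundedOfCompact K F).continuous.comp T.curry.continuous)
  refine (isCompact_range hΦ).totallyBounded.subset ?_
  rintro _ ⟨s, rfl⟩
  refine ⟨ι s, ?_⟩
  ext x
  exact congrArg h (map_add ι s x).symm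

theorem IsCharacterCombination.comp_addMonoidHom {K : Type*} [AddCommGroup K] [TopologicalSpace K]
    {ι : G →+ K} (hι : Continuous ι) {q : C(K, ℂ)}
    (hq : q ∈ Submodule.span ℂ {χ : C(K, ℂ) | IsCharacter χ}) :
    IsCharacterCombination fun x => q (ι x) := by
  induction hq using Submodule.span_induction with
  | mem χ hχ =>
    exact Submodule.subset_span ⟨hχ.continuous.comp hι, fun x => hχ.norm_eq_one _,
      fun x y => by rw [map_add, hχ.map_add]⟩
  | zero => exact Submodule.zero_mem _
  | add p q _ _ hp hq => exact Submodule.add_mem _ hp hq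
  | smul c p _ hp => exact Submodule.smul_mem _ c hp

theorem IsCharacterCombination.conj {p : G → ℂ} (hp : IsCharacterCombination p) :
    IsCharacterCombination fun x => conj (p x) := by
  induction hp using Submodule.span_induction with
  | mem χ hχ =>
    exact Submodule.subset_span ⟨Complex.continuous_conj.comp hχ.continuous,
      fun x => by simp [hχ.norm_eq_one], fun x y => by simp [hχ.map_add]⟩
  | zero =>
    simp only [Pi.zero_apply, map_zero]
    exact Submodule.zero_mem _
  | add p q _ _ hp hq =>
    simp only [Pi.add_apply, map_add]
    exact Submodule.add_mem _ hp hq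
  | smul c p _ hp =>
    simp only [Pi.smul_apply, smul_eq_mul, map_mul]
    exact Submodule.smul_mem _ (starRingEnd ℂ c) hp

/-- Projecting to `F` either changes nothing or takes the real part, which is the mean of a
combination of characters and its conjugate. -/
theorem IsCharacterCombination.map_map {p : G → ℂ} (hp : IsCharacterCombination p) :
    IsCharacterCombination fun x => RCLike.map F ℂ (RCLike.map ℂ F (p x)) := by
  rcases RCLike.I_eq_zero_or_im_I_eq_one (K := F) with h | h
  · have h1 : (fun x => RCLike.map F ℂ (RCLike.map ℂ F (p x))) =
        (1 / 2 : ℂ) • (p + fun x => (starRingEnd ℂ) (p x)) := by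
      ext x
      simp [h, Complex.re_eq_add_conj]
      ring
    rw [h1]
    exact Submodule.smul_mem _ _ (Submodule.add_mem _ hp hp.conj)
  · have h1 : (fun x => RCLike.map F ℂ (RCLike.map ℂ F (p x))) = p := by
      ext x
      simp [h]
    rwa [h1]

theorem map_map_complex (z : F) : RCLike.map ℂ F (RCLike.map F ℂ z) = z := by
  simp

theorem norm_map_complex_le (z : ℂ) : ‖RCLike.map ℂ F z‖ ≤ ‖z‖ := by
  rw [← sq_le_sq₀ (norm_nonneg _) (norm_nonneg _), ← RCLike.normSq_eq_def', ← RCLike.normSq_eq_def',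
    RCLike.normSq_apply, RCLike.normSq_apply]
  rcases RCLike.I_eq_zero_or_im_I_eq_one (K := F) with h | h
  · simpa [h] using mul_self_nonneg z.im
  · simp [h]

end Pullback
end BohrAP

theorem mainTheorem2 {G F : Type*} [AddCommGroup G] [TopologicalSpace G]
    [IsTopologicalAddGroup G] [RCLike F] (f : G →ᵇ F) (hf : BohrAP.IsAlmostPeriodic f)
    (ε : ℝ) (hε : 0 < ε) :
    ∃ p : G →ᵇ F, BohrAP.IsAlmostPeriodic p ∧
      BohrAP.IsCharacterCombination (fun x => RCLike.map F ℂ (p x)) ∧ ‖f - p‖ < ε := by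
  obtain ⟨K, _, _, ι, h, hι, hh⟩ := hf.exists_compactSpace_extension
  obtain ⟨q, hq, hhq⟩ := BohrAP.exists_mem_span_character_norm_sub_lt
    ((RCLike.map F ℂ : C(F, ℂ)).comp h) (half_pos hε)
  let P : C(K, F) := (RCLike.map ℂ F : C(ℂ, F)).comp q
  refine ⟨(BoundedContinuousFunction.mkOfCompact P).compContinuous ⟨ι, hι⟩,
    BohrAP.isAlmostPeriodic_comp_of_compactSpace hι P,
    (BohrAP.IsCharacterCombination.comp_addMonoidHom hι hq).map_map, ?_⟩
  refine lt_of_le_of_lt ((BoundedContinuousFunction.norm_le (half_pos hε).le).2 fun x => ?_)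
    (half_lt_self hε)
  change ‖f x - RCLike.map ℂ F (q (ι x))‖ ≤ ε / 2
  rw [← hh, ← BohrAP.map_map_complex (h (ι x)), ← map_sub]
  exact (BohrAP.norm_map_complex_le _).trans
    ((ContinuousMap.norm_coe_le_norm (((RCLike.map F ℂ : C(F, ℂ)).comp h) - q) (ι x)).trans hhq.le)
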